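/- Let $\mathcal F$ be a signature, $\mathcal V$ an infinite set of variables, and $\mathcal R$ a (possibly infinite) term rewrite system over $\mathcal F$ and $\mathcal V$; rules $l \to r$ are arbitrary pairs of terms ($l$ may be a variable, and $r$ may contain variables that are not in $l$). Call $\mathcal R$ linear if in both sides of every rule each variable occurs at most once. A rewrite step $s \to^{\pi} t$ has a redex pattern $\pi = \langle p, l\to r, \sigma\rangle$ with $l \to r \in \mathcal R$, $s|_p = l\sigma$ and $t = s[r\sigma]_p$. Given $i\colon \mathcal R \to \mathbb N$, the rule labeling $\ell^i$ labels a step $s \to^{\pi} t$, as well as its reverse reading $t \mathrel{{}^{\pi}{\leftarrow}} s$, by $i(l \to r)$; labels are compared by $>$ and $\geqslant$ on $\mathbb N$. Definitions. * A function $\ell$ on rewrite steps is a labeling if $\ell(s\to^\pi t) = \ell(t \mathrel{{}^{\pi}{\leftarrow}} s)$ and if, for all contexts $C$ and substitutions $\sigma$, $\ell(s \to^{\pi_1} t) \mathrel{\rhd} \ell(u \to^{\pi_2} v)$ implies $\ell(C[s\sigma] \to^{C[\pi_1\sigma]} C[t\sigma]) \mathrel{\rhd} \ell(C[u\sigma]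 \to^{C[\pi_2\sigma]} C[v\sigma])$, both for ${\rhd} = {>}$ and for ${\rhd} = {\geqslant}$. Here $C[\pi\sigma] = \langle qp, l\to r, \tau\sigma\rangle$ for $\pi = \langle p, l\to r,\tau\rangle$ and $q$ the position of the hole of $C$. * A local peak $t \mathrel{{}^{\pi_1}{\leftarrow}} s \to^{\pi_2} u$ whose two steps have labels $\alpha$ and $\beta$ is extended locally decreasing for $\ell$ if there are $t', t'', u'', u'$ with $t \leftrightarrow^* t' \to^{=} t'' \leftrightarrow^* u'' \mathrel{{}^{=}{\leftarrow}} u' \leftrightarrow^* u$ (where ${}^{=}$ means at most one step), such that every step label $\gamma$ in the five parts satisfies, respectively: $\alpha > \gamma$; $\beta \geqslant \gamma$; $\alpha > \gamma$ or $\beta > \gamma$; $\alpha \geqslant \gamma$; $\beta > \gamma$. * The local peak is a parallel peak if the positions $p_1, p_2$ of its steps are parallel, and a variable peak if $p_1 = p_2q'$ where $q'$ is not a function symbol position of the left-hand side $l_2$ of the rule of the right step. A labeling is compatible with $\mathcal R$ if all parallel peaks and all variable peaks of $\mathcal R$ are extended locally decreasing for it. * A critical peak of $\mathcal R$ is $l_2\mu[r_1\mu]_p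 \leftarrow l_2\mu \to r_2\mu$, where $l_1 \to r_1$ and $l_2 \to r_2$ are variants of rules of $\mathcal R$ without common variables, $p$ is a function symbol position of $l_2$, and $\mu$ is a most general unifier of $l_1$ and $l_2|_p$ (root overlaps of a rule with a variant of itself are included). Its steps use the rules of $\mathcal R$ of which the two are variants. Then, for every $i\colon \mathcal R \to \mathbb N$: 1. The rule labeling $\ell^i$ is a labeling. 2. If $\mathcal R$ is linear, then $\ell^i$ is compatible with $\mathcal R$. 3. If $\mathcal R$ is linear and all critical peaks of $\mathcal R$ are extended locally decreasing for $\ell^i$, then $\mathcal R$ is confluent, i.e. $s \to_{\mathcal R}^* t$ and $s \to_{\mathcal R}^* u$ imply that there is $v$ with $t \to_{\mathcal R}^* v$ and $u \to_{\mathcal R}^* v$. -/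

import Mathlib

namespace Rewriting

universe u v w

variable {L : FirstOrder.Language.{u, v}} {V : Type w}

/-! ### Terms

A signature is given by the function symbols (with arities) of a first-order language `L`; its
relation symbols play no role. `L.Term V` is the type of terms over this signature with variables
`V`. A substitution is a map `V → L.Term V`, applied by `Term.subst`. -/

/-- The number of occurrences of the variable `x` in a term. -/
noncomputable def occ (x : V) : L.Term V → ℕ
  | .var y => open Classical in if y = x then 1 else 0
  | .func _ ts => ∑ j, occ x (ts j)

/-- A term is linear if no variable occurs in it more than once. -/
def LinearTerm (t : L.Term V) : Prop := ∀ x, occ x t ≤ 1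

/-- The subterm of a term at a position, if the position exists in the term. Positions are finite
strings of argument indices, where the arguments of a function symbol are counted from `0`. -/
def subtermAt : L.Term V → List ℕ → Option (L.Term V)
  | t, [] => some t
  | .var _, _ :: _ => none
  | .func (l := n) _ ts, j :: q => if h : j < n then subtermAt (ts ⟨j, h⟩) q else none

/-- `replaceAt s p t` is `s[t]_p`, for a position `p` of `s` (for other `p` it is `s`). -/
def replaceAt : L.Term V → List ℕ → L.Term V → L.Term V
  | _, [], t => t
  | .var x, _ :: _, _ => .var x
  | .func (l := n) f ts, j :: q, t =>
      if h : j < n then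
        .func f (Function.update ts ⟨j, h⟩ (replaceAt (ts ⟨j, h⟩) q t))
      else .func f ts

/-- `p` is a function symbol position of `t`. -/
def IsFunPos (t : L.Term V) (p : List ℕ) : Prop :=
  ∃ s, subtermAt t p = some s ∧ ∀ x, s ≠ .var x

/-- Two positions are parallel if none is a prefix of the other. -/
def ParallelPos (p q : List ℕ) : Prop := ¬ p <+: q ∧ ¬ q <+: p

/-- Contexts. In `node f j ts C` the `j`-th argument of `f` is `C`, the others are given by `ts`
(the value `ts j` is ignored). -/
inductive Context (L : FirstOrder.Language.{u, v}) (V : Type w) : Type (max u w)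
  | hole : Context L V
  | node {n : ℕ} (f : L.Functions n) (j : Fin n) (ts : Fin n → L.Term V) (C : Context L V) :
      Context L V

/-- `C.fill t` is `C[t]`. -/
def Context.fill : Context L V → L.Term V → L.Term V
  | .hole, t => t
  | .node f j ts C, t => .func f (Function.update ts j (C.fill t))

/-- The position of the hole. -/
def Context.holePos : Context L V → List ℕ
  | .hole => []
  | .node _ j _ C => (j : ℕ) :: C.holePos

/-! ### Term rewrite systems -/

/-- A rewrite rule is an arbitrary pair of terms: the left-hand side may be a variable, and the
right-hand side may have variables that do not occur on the left. -/
structure Rule (L : FirstOrder.Language.{u, v}) (V : Type w) : Type (max u w) where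
  lhs : L.Term V
  rhs : L.Term V

/-- The variables of a rule. -/
def Rule.vars (ρ : Rule L V) : Set V := {x | 0 < occ x ρ.lhs ∨ 0 < occ x ρ.rhs}

/-- The variant of a rule obtained by renaming its variables. -/
def Rule.rename (e : Equiv.Perm V) (ρ : Rule L V) : Rule L V :=
  ⟨ρ.lhs.relabel e, ρ.rhs.relabel e⟩

/-- A term rewrite system: a (possibly infinite) set of rules. -/
abbrev TRS (L : FirstOrder.Language.{u, v}) (V : Type w) : Type (max u w) := Set (Rule L V)

/-- A TRS is linear if both sides of all its rules are linear. -/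
def LinearTRS (R : TRS L V) : Prop := ∀ ρ ∈ R, LinearTerm ρ.lhs ∧ LinearTerm ρ.rhs

/-- The rewrite relation of `R`: the smallest relation that contains `R` and is closed under
substitutions and contexts. -/
inductive Rewrites (R : TRS L V) : L.Term V → L.Term V → Prop
  | rule (ρ : Rule L V) (h : ρ ∈ R) : Rewrites R ρ.lhs ρ.rhs
  | subst (σ : V → L.Term V) {s t : L.Term V} (h : Rewrites R s t) :
      Rewrites R (s.subst σ) (t.subst σ)
  | context (C : Context L V) {s t : L.Term V} (h : Rewrites R s t) :
      Rewrites R (C.fill s) (C.fill t)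

/-- A TRS is confluent if `←* · →*` is contained in `→* · ←*`. -/
def Confluent (R : TRS L V) : Prop :=
  ∀ s t u : L.Term V, Relation.ReflTransGen (Rewrites R) s t →
    Relation.ReflTransGen (Rewrites R) s u →
    ∃ v, Relation.ReflTransGen (Rewrites R) t v ∧ Relation.ReflTransGen (Rewrites R) u v

/-- A rewrite step `s →^π t` of `R` with its redex pattern `π = ⟨p, l → r, σ⟩`. -/
structure Step (R : TRS L V) where
  source : L.Term V
  target : L.Term V
  pos : List ℕ
  rule : R
  subst : V → L.Term V
  source_at : subtermAt source pos = some (rule.1.lhs.subst subst)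
  target_eq : target = replaceAt source pos (rule.1.rhs.subst subst)

/-! ### Facts needed to close steps under contexts and substitutions -/

theorem subst_subst (t : L.Term V) (σ τ : V → L.Term V) :
    (t.subst σ).subst τ = t.subst (fun x => (σ x).subst τ) := by
  induction t with
  | var x => rfl
  | func f ts ih => simp only [FirstOrder.Language.Term.subst]; congr 1; funext j; exact ih j

theorem relabel_subst (t : L.Term V) (g : V → V) (σ : V → L.Term V) :
    (t.relabel g).subst σ = t.subst (fun x => σ (g x)) := by
  induction t with
  | var x => rfl
  | func f ts ih => simp only [FirstOrder.Language.Term.subst, FirstOrder.Language.Term.relabel]; congr 1; funext j; exact ih j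

theorem subtermAt_subst (σ : V → L.Term V) {s t : L.Term V} {p : List ℕ}
    (h : subtermAt s p = some t) : subtermAt (s.subst σ) p = some (t.subst σ) := by
  induction p generalizing s with
  | nil => simp only [subtermAt, Option.some.injEq] at h ⊢; rw [h]
  | cons j q ih =>
    cases s with
    | var x => simp [subtermAt] at h
    | @func n f ts =>
      by_cases hj : j < n
      · simp only [subtermAt, hj, dite_true, FirstOrder.Language.Term.subst] at h ⊢; exact ih h
      · simp [subtermAt, hj] at h

theorem replaceAt_subst (σ : V → L.Term V) {s t : L.Term V} {p : List ℕ}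
    (h : subtermAt s p = some t) (r : L.Term V) :
    (replaceAt s p r).subst σ = replaceAt (s.subst σ) p (r.subst σ) := by
  induction p generalizing s with
  | nil => simp only [replaceAt]
  | cons j q ih =>
    cases s with
    | var x => simp [subtermAt] at h
    | @func n f ts =>
      by_cases hj : j < n
      · simp only [subtermAt, hj, dite_true] at h
        simp only [replaceAt, hj, dite_true, FirstOrder.Language.Term.subst]
        congr 1
        funext k
        by_cases hk : k = ⟨j, hj⟩
        · subst hk; simp [ih h]
        · simp [Function.update_of_ne hk]
      · simp [subtermAt, hj] at h

theorem subtermAt_fill (C : Context L V) (t : L.Term V) (p : List ℕ) :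
    subtermAt (C.fill t) (C.holePos ++ p) = subtermAt t p := by
  induction C with
  | hole => rfl
  | node f j ts C ih => simp [Context.fill, Context.holePos, subtermAt, ih]

theorem replaceAt_fill (C : Context L V) (t r : L.Term V) (p : List ℕ) :
    replaceAt (C.fill t) (C.holePos ++ p) r = C.fill (replaceAt t p r) := by
  induction C with
  | hole => rfl
  | node f j ts C ih => simp [Context.fill, Context.holePos, replaceAt, ih]

/-- The step `C[sσ] → C[tσ]` with redex pattern `C[πσ] = ⟨qp, l → r, τσ⟩`, for a step `s → t` with
redex pattern `π = ⟨p, l → r, τ⟩` and the position `q` of the hole of `C`. -/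
def Step.inst {R : TRS L V} (C : Context L V) (σ : V → L.Term V) (a : Step R) : Step R where
  source := C.fill (a.source.subst σ)
  target := C.fill (a.target.subst σ)
  pos := C.holePos ++ a.pos
  rule := a.rule
  subst := fun x => (a.subst x).subst σ
  source_at := by
    rw [subtermAt_fill, subtermAt_subst σ a.source_at, subst_subst]
  target_eq := by
    rw [replaceAt_fill, a.target_eq, replaceAt_subst σ a.source_at, subst_subst]

/-! ### Conversions and labelings -/

/-- A rewrite step together with a direction: forward `s → t` or backward `t ← s`. -/
structure DirStep (R : TRS L V) where
  step : Step R
  forward : Bool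

/-- The step `s → t`, read from left to right. -/
def Step.fwd {R : TRS L V} (a : Step R) : DirStep R := ⟨a, true⟩

/-- The step `t ← s`, read from left to right. -/
def Step.bwd {R : TRS L V} (a : Step R) : DirStep R := ⟨a, false⟩

/-- The term on the left of a directed step. -/
def DirStep.start {R : TRS L V} (d : DirStep R) : L.Term V :=
  if d.forward then d.step.source else d.step.target

/-- The term on the right of a directed step. -/
def DirStep.finish {R : TRS L V} (d : DirStep R) : L.Term V :=
  if d.forward then d.step.target else d.step.source

/-- The list of directed steps is a conversion from `s` to `t`. -/
def IsConversion {R : TRS L V} : L.Term V → List (DirStep R) → L.Term V → Prop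
  | s, [], t => s = t
  | s, d :: c, t => d.start = s ∧ IsConversion d.finish c t

/-- The list is an optional forward step `s →⁼ t`. -/
def IsOptForward {R : TRS L V} (s : L.Term V) (c : List (DirStep R)) (t : L.Term V) : Prop :=
  IsConversion s c t ∧ c.length ≤ 1 ∧ ∀ d ∈ c, d.forward = true

/-- The list is an optional backward step `s ⁼← t`. -/
def IsOptBackward {R : TRS L V} (s : L.Term V) (c : List (DirStep R)) (t : L.Term V) : Prop :=
  IsConversion s c t ∧ c.length ≤ 1 ∧ ∀ d ∈ c, d.forward = false

/-- The labeling function `ℓ` on the (directed) steps of `R` is a labeling with respect to the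
relations `gt` and `ge` on labels. -/
structure IsLabeling {R : TRS L V} {Λ : Type*} (ℓ : DirStep R → Λ) (gt ge : Λ → Λ → Prop) :
    Prop where
  gt_inst : ∀ (C : Context L V) (σ : V → L.Term V) (a b : Step R),
    gt (ℓ a.fwd) (ℓ b.fwd) → gt (ℓ (a.inst C σ).fwd) (ℓ (b.inst C σ).fwd)
  ge_inst : ∀ (C : Context L V) (σ : V → L.Term V) (a b : Step R),
    ge (ℓ a.fwd) (ℓ b.fwd) → ge (ℓ (a.inst C σ).fwd) (ℓ (b.inst C σ).fwd)
  symm : ∀ a : Step R, ℓ a.fwd = ℓ a.bwd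

/-- The set of labels of a conversion. -/
def labels {R : TRS L V} {Λ : Type*} (ℓ : DirStep R → Λ) (c : List (DirStep R)) : Set Λ :=
  {β | ∃ d ∈ c, ℓ d = β}

/-- All labels `β` with `rel α β` for some `α ∈ S`. -/
def below {Λ : Type*} (rel : Λ → Λ → Prop) (S : Set Λ) : Set Λ := {β | ∃ α ∈ S, rel α β}

/-- The local peak `t ← s → u`, consisting of the steps `a : s → t` and `b : s → u` with a common
source, is extended locally decreasing: there is a local diagram
`t ↔* t' →⁼ t'' ↔* u'' ⁼← u' ↔* u` with suitable labels. -/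
def ExtLocDecreasing {R : TRS L V} {Λ : Type*} (ℓ : DirStep R → Λ) (gt ge : Λ → Λ → Prop)
    (a b : Step R) : Prop :=
  ∃ (t' t'' u'' u' : L.Term V) (c₁ c₂ c₃ c₄ c₅ : List (DirStep R)),
    IsConversion a.target c₁ t' ∧ IsOptForward t' c₂ t'' ∧ IsConversion t'' c₃ u'' ∧
    IsOptBackward u'' c₄ u' ∧ IsConversion u' c₅ b.target ∧
    labels ℓ c₁ ⊆ below gt {ℓ a.bwd} ∧
    labels ℓ c₂ ⊆ below ge {ℓ b.fwd} ∧
    labels ℓ c₃ ⊆ below gt {ℓ a.bwd, ℓ b.fwd} ∧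
    labels ℓ c₄ ⊆ below ge {ℓ a.bwd} ∧
    labels ℓ c₅ ⊆ below gt {ℓ b.fwd}

/-! ### Local peaks and critical peaks -/

/-- The steps `a : s → t` and `b : s → u` form a local peak `t ← s → u`. -/
def IsLocalPeak {R : TRS L V} (a b : Step R) : Prop := a.source = b.source

/-- A parallel peak: the two steps take place at parallel positions. -/
def IsParallelPeak {R : TRS L V} (a b : Step R) : Prop :=
  IsLocalPeak a b ∧ ParallelPos a.pos b.pos

/-- A variable peak: the position of `a` is that of `b` followed by some `q'` that is not a function
symbol position of the left-hand side of the rule of `b`. -/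
def IsVariablePeak {R : TRS L V} (a b : Step R) : Prop :=
  IsLocalPeak a b ∧ ∃ q', a.pos = b.pos ++ q' ∧ ¬ IsFunPos b.rule.1.lhs q'

/-- A labeling function is compatible with the TRS if it is a labeling and all parallel peaks and
all variable peaks are extended locally decreasing. -/
structure Compatible {R : TRS L V} {Λ : Type*} (ℓ : DirStep R → Λ) (gt ge : Λ → Λ → Prop) :
    Prop where
  labeling : IsLabeling ℓ gt ge
  parallel : ∀ a b : Step R, IsParallelPeak a b → ExtLocDecreasing ℓ gt ge a b
  variable_peak : ∀ a b : Step R, IsVariablePeak a b → ExtLocDecreasing ℓ gt ge a b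

/-- `μ` is a most general unifier of `s` and `t`. -/
def IsMGU (μ : V → L.Term V) (s t : L.Term V) : Prop :=
  s.subst μ = t.subst μ ∧
    ∀ τ : V → L.Term V, s.subst τ = t.subst τ → ∃ δ : V → L.Term V, ∀ x, τ x = (μ x).subst δ

/-- A critical overlap `(l₁ → r₁, p, l₂ → r₂)_μ` of `R`, where `l₁ → r₁` and `l₂ → r₂` are the
variants of rules `rule₁` and `rule₂` of `R` under the renamings `ren₁` and `ren₂`. Root overlaps of
a rule with a variant of itself are not excluded. -/
structure CriticalOverlap (R : TRS L V) where
  rule₁ : R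
  rule₂ : R
  ren₁ : Equiv.Perm V
  ren₂ : Equiv.Perm V
  apart : Disjoint (rule₁.1.rename ren₁).vars (rule₂.1.rename ren₂).vars
  pos : List ℕ
  funPos : IsFunPos (rule₂.1.rename ren₂).lhs pos
  mgu : V → L.Term V
  isMGU : ∀ s, subtermAt (rule₂.1.rename ren₂).lhs pos = some s →
    IsMGU mgu (rule₁.1.rename ren₁).lhs s

/-- The step `l₂μ → l₂μ[r₁μ]_p` of the critical peak of an overlap. It is a step with the rule
`rule₁` of `R`, of which `l₁ → r₁` is a variant. -/
def CriticalOverlap.inner {R : TRS L V} (o : CriticalOverlap R) : Step R where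
  source := (o.rule₂.1.rename o.ren₂).lhs.subst o.mgu
  target := replaceAt ((o.rule₂.1.rename o.ren₂).lhs.subst o.mgu) o.pos
    ((o.rule₁.1.rename o.ren₁).rhs.subst o.mgu)
  pos := o.pos
  rule := o.rule₁
  subst := fun x => o.mgu (o.ren₁ x)
  source_at := by
    obtain ⟨s, hs, -⟩ := o.funPos
    rw [subtermAt_subst o.mgu hs, ← (o.isMGU s hs).1]
    exact congrArg some (relabel_subst _ _ _)
  target_eq := by
    congr 1; exact relabel_subst _ _ _

/-- The step `l₂μ → r₂μ` of the critical peak of an overlap. -/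
def CriticalOverlap.outer {R : TRS L V} (o : CriticalOverlap R) : Step R where
  source := (o.rule₂.1.rename o.ren₂).lhs.subst o.mgu
  target := (o.rule₂.1.rename o.ren₂).rhs.subst o.mgu
  pos := []
  rule := o.rule₂
  subst := fun x => o.mgu (o.ren₂ x)
  source_at := by
    simp only [subtermAt]; exact congrArg some (relabel_subst _ _ _)
  target_eq := by
    simp only [replaceAt]; exact relabel_subst _ _ _

/-- All critical peaks `l₂μ[r₁μ]_p ← l₂μ → r₂μ` of the TRS are extended locally decreasing. -/
def CriticalPeaksDecreasing {R : TRS L V} {Λ : Type*} (ℓ : DirStep R → Λ)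
    (gt ge : Λ → Λ → Prop) : Prop :=
  ∀ o : CriticalOverlap R, ExtLocDecreasing ℓ gt ge o.inner o.outer

/-- The rule labeling for an index mapping `i` on the rules of `R`: a step is labeled by the index
of the rule it applies. -/
def ruleLabeling {R : TRS L V} (i : R → ℕ) : DirStep R → ℕ := fun d => i d.step.rule

end Rewriting

namespace Rewriting

universe u v w

variable {L : FirstOrder.Language.{u, v}} {V : Type w}

open FirstOrder.Language (Term)

/-! Confluence follows from decreasing diagrams in the form where the outer and middle parts of a
diagram are conversions. As labels are natural numbers, no measure on conversions is needed:
induction on a bound `k` for labels suffices. The invariant (`PeaksModuloDecreasing`) is that two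
steps with labels at least `k`, whose sources are connected by a conversion with labels below `k`,
still have a decreasing diagram. For `k = 0` this is local decreasingness. In passing from `j` to `j
+ 1`, label-`j` steps modulo smaller labels have the diamond property, so a conversion with labels
at most `j` becomes a valley modulo smaller labels. The two outer steps are pushed down its sides,
and their residues again form a peak covered by the invariant for `j`. Since valleys obtained this
way still contain conversions, a second induction (`RewritesBefore`) replaces them by genuine
rewriting, which gives the Church–Rosser property (`ConvBelow.join`).

For a linear system every local peak is parallel, a variable peak, or an instance of a critical
peak. Parallel steps commute. In a variable peak, linearity of the left-hand side keeps the outer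
redex intact, and linearity of the right-hand side leaves at most one copy of the inner redex. The
closing steps thus reuse the rules of the peak, hence its labels. In the remaining case the diagram
of the critical peak is instantiated (`exists_criticalOverlap`), which does not change the rules. -/

/-! ### Decreasing diagrams for conversions, with labels in `ℕ` -/

section Abstract

open Relation

variable {A : Type*} (r : ℕ → A → A → Prop)

/-- Convertibility by steps with labels less than `k`. -/
def ConvBelow (k : ℕ) : A → A → Prop :=
  ReflTransGen fun s t => ∃ n < k, r n s t ∨ r n t s

/-- At most one step, with label `n`. -/
def OptStep (n : ℕ) (s t : A) : Prop := s = t ∨ r n s t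

/-- `s` and `t` are connected by a diagram that is decreasing for the labels `m` and `n`. -/
def DecreasingJoin (m n : ℕ) (s t : A) : Prop :=
  ∃ s' s'' t'' t', ConvBelow r m s s' ∧ OptStep r n s' s'' ∧ ConvBelow r (max m n) s'' t'' ∧
    OptStep r m t' t'' ∧ ConvBelow r n t' t

/-- At most one step with label `n`, modulo convertibility with smaller labels. -/
def OptStepModulo (n : ℕ) (s t : A) : Prop :=
  ∃ s' t', ConvBelow r n s s' ∧ OptStep r n s' t' ∧ ConvBelow r n t' t

variable {r}

theorem ConvBelow.mono {k l : ℕ} (h : k ≤ l) {s t : A} (hst : ConvBelow r k s t) :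
    ConvBelow r l s t :=
  ReflTransGen.mono (fun _ _ ⟨n, hn, hr⟩ => ⟨n, hn.trans_le h, hr⟩) _ _ hst

theorem ConvBelow.refl (k : ℕ) (s : A) : ConvBelow r k s s := ReflTransGen.refl

theorem ConvBelow.trans {k : ℕ} {s t u : A} (h₁ : ConvBelow r k s t) (h₂ : ConvBelow r k t u) :
    ConvBelow r k s u := ReflTransGen.trans h₁ h₂

theorem ConvBelow.symm {k : ℕ} {s t : A} (h : ConvBelow r k s t) : ConvBelow r k t s := by
  induction h with
  | refl => exact .refl _ _
  | tail _ h ih =>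
    obtain ⟨n, hn, hr⟩ := h
    exact ReflTransGen.head ⟨n, hn, hr.symm⟩ ih

theorem ConvBelow.eq_of_zero {s t : A} (h : ConvBelow r 0 s t) : s = t := by
  induction h with
  | refl => rfl
  | tail _ h _ => obtain ⟨n, hn, _⟩ := h; exact absurd hn (Nat.not_lt_zero n)

theorem ConvBelow.of_step {k n : ℕ} (hn : n < k) {s t : A} (h : r n s t) : ConvBelow r k s t :=
  ReflTransGen.single ⟨n, hn, Or.inl h⟩

theorem OptStep.convBelow {k n : ℕ} (hn : n < k) {s t : A} (h : OptStep r n s t) :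
    ConvBelow r k s t := by
  rcases h with rfl | h
  · exact .refl _ _
  · exact .of_step hn h

theorem ConvBelow.optStepModulo {n : ℕ} {s t : A} (h : ConvBelow r n s t) :
    OptStepModulo r n s t := ⟨s, s, .refl _ _, Or.inl rfl, h⟩

theorem DecreasingJoin.symm {m n : ℕ} {s t : A} (h : DecreasingJoin r m n s t) :
    DecreasingJoin r n m t s := by
  obtain ⟨s', s'', t'', t', h₁, h₂, h₃, h₄, h₅⟩ := h
  exact ⟨t', t'', s'', s', h₅.symm, h₄, by rw [max_comm]; exact h₃.symm, h₂, h₁.symm⟩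

/-! ### Peaks modulo conversions with smaller labels -/

/-- Peaks around a conversion with labels less than `k` are decreasing. -/
def PeaksModuloDecreasing (r : ℕ → A → A → Prop) (k : ℕ) : Prop :=
  ∀ m n, k ≤ m → k ≤ n → ∀ s s' t u, r m s t → ConvBelow r k s s' → r n s' u →
    DecreasingJoin r m n t u

/-- The diamond property modulo smaller labels makes steps with labels at most `j`
Church–Rosser modulo. -/
theorem PeaksModuloDecreasing.join {j : ℕ} (hX : PeaksModuloDecreasing r j) {s t : A}
    (h : ConvBelow r (j + 1) s t) :
    ∃ v, ReflTransGen (OptStepModulo r j) s v ∧ ReflTransGen (OptStepModulo r j) t v := by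
  -- For `m = n = j` every conversion in the decreasing diagram has labels below `j`, so each side
  -- collapses to one step modulo smaller labels.
  have diamond : ∀ a b c, OptStepModulo r j a b → OptStepModulo r j a c →
      ∃ d, ReflGen (OptStepModulo r j) b d ∧ ReflTransGen (OptStepModulo r j) c d := by
    rintro a b c ⟨a₁, b₁, ha, hab, hb⟩ ⟨a₂, c₁, ha', hac, hc⟩
    rcases hab with rfl | hab
    · exact ⟨c, .single ⟨a₂, c₁, (hb.symm.trans ha.symm).trans ha', hac, hc⟩, .refl⟩
    rcases hac with rfl | hac
    · exact ⟨b, .refl, .single ⟨a₁, b₁, (hc.symm.trans ha'.symm).trans ha, Or.inr hab, hb⟩⟩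
    obtain ⟨s', s'', t'', t', h₁, h₂, h₃, h₄, h₅⟩ :=
      hX j j le_rfl le_rfl _ _ _ _ hab (ha.symm.trans ha') hac
    rw [max_self] at h₃
    exact ⟨t'', .single ⟨s', s'', hb.symm.trans h₁, h₂, h₃⟩,
      .single ⟨t', t'', hc.symm.trans h₅.symm, h₄, .refl _ _⟩⟩
  have sym : ∀ {a b}, OptStepModulo r j a b → Join (ReflTransGen (OptStepModulo r j)) a b :=
    fun h => ⟨_, .single h, .refl⟩
  have step : ∀ {a b}, r j a b → OptStepModulo r j a b :=
    fun h => ⟨_, _, .refl _ _, Or.inr h, .refl _ _⟩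
  induction h with
  | refl => exact ⟨_, .refl, .refl⟩
  | @tail b c _ hbc ih =>
    have htrans := (equivalence_join_reflTransGen diamond)
    refine htrans.trans ih ?_
    obtain ⟨n, hn, hr⟩ := hbc
    rcases Nat.lt_succ_iff_lt_or_eq.mp hn with hn | rfl
    · exact sym (ConvBelow.optStepModulo (ReflTransGen.single ⟨n, hn, hr⟩))
    · rcases hr with hr | hr
      · exact sym (step hr)
      · exact htrans.symm (sym (step hr))

/-- A step with a label above `j` is pushed forward along steps with label `j`. -/
theorem PeaksModuloDecreasing.push {j m : ℕ} (hX : PeaksModuloDecreasing r j) (hm : j < m)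
    {s t v : A} (hst : r m s t) (hsv : ReflTransGen (OptStepModulo r j) s v) :
    ConvBelow r m t v ∨ ∃ t₁ s₁, ConvBelow r m t t₁ ∧ r m s₁ t₁ ∧ ConvBelow r j s₁ v := by
  induction hsv with
  | refl => exact Or.inr ⟨t, s, .refl _ _, hst, .refl _ _⟩
  | @tail b c _ hbc ih =>
    obtain ⟨b', c', hb, hbc, hc⟩ := hbc
    rcases ih with ih | ⟨t₁, s₁, ht, hs, hv⟩
    · exact Or.inl (((ih.trans (hb.mono hm.le)).trans (hbc.convBelow hm)).trans (hc.mono hm.le))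
    rcases hbc with rfl | hbc
    · exact Or.inr ⟨t₁, s₁, ht, hs, (hv.trans hb).trans hc⟩
    -- As `j < m`, everything in this diagram except the residue `h₄` of the label-`m` step has
    -- labels below `m`, and the part `h₅` after the residue has labels below `j`. If the residue is
    -- empty, only a conversion below `m` remains.
    obtain ⟨s', s'', t'', t', h₁, h₂, h₃, h₄, h₅⟩ :=
      hX m j hm.le le_rfl _ _ _ _ hs (hv.trans hb) hbc
    rw [max_eq_left hm.le] at h₃
    have key := ((ht.trans h₁).trans (h₂.convBelow hm)).trans h₃
    rcases h₄ with rfl | h₄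
    · exact Or.inl ((key.trans (h₅.mono hm.le)).trans (hc.mono hm.le))
    · exact Or.inr ⟨t'', t', key, h₄, h₅.trans hc⟩

/-- The conversion between the sources is turned into a valley with bottom `v`, and both steps are
pushed to `v`. If both survive, their residues have sources connected below `j`, so the hypothesis
closes them; the conversions passed on the way have labels below `m` and below `n` and are absorbed
at the two ends. -/
theorem PeaksModuloDecreasing.succ {j : ℕ} (hX : PeaksModuloDecreasing r j) :
    PeaksModuloDecreasing r (j + 1) := by
  intro m n hm hn s s' t u hst hss hsu
  have hm : j < m := hm
  have hn : j < n := hn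
  obtain ⟨v, hsv, hsv'⟩ := hX.join hss
  rcases hX.push hm hst hsv with ht | ⟨t₁, s₁, ht, hs, hv⟩ <;>
    rcases hX.push hn hsu hsv' with hu | ⟨u₁, s₂, hu, hs', hv'⟩
  · exact ⟨v, v, v, v, ht, Or.inl rfl, .refl _ _, Or.inl rfl, hu.symm⟩
  · exact ⟨s₂, u₁, u₁, u₁, ht.trans (hv'.symm.mono hm.le), Or.inr hs', .refl _ _, Or.inl rfl,
      hu.symm⟩
  · exact ⟨t₁, t₁, t₁, s₁, ht, Or.inl rfl, .refl _ _, Or.inr hs,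
      (hv.mono hn.le).trans hu.symm⟩
  · obtain ⟨a, b, c, d, h₁, h₂, h₃, h₄, h₅⟩ :=
      hX m n hm.le hn.le _ _ _ _ hs (hv.trans hv'.symm) hs'
    exact ⟨a, b, c, d, ht.trans h₁, h₂, h₃, h₄, h₅.trans hu.symm⟩

theorem peaksModuloDecreasing
    (hr : ∀ m n s t u, r m s t → r n s u → DecreasingJoin r m n t u) (k : ℕ) :
    PeaksModuloDecreasing r k := by
  induction k with
  | zero =>
    intro m n _ _ s s' t u hst hss hsu
    obtain rfl := hss.eq_of_zero
    exact hr m n s t u hst hsu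
  | succ j ih => exact ih.succ

/-! ### From conversions to genuine rewrite sequences -/

/-- The union of the step relations. -/
def AnyStep (r : ℕ → A → A → Prop) (s t : A) : Prop := ∃ n, r n s t

theorem OptStep.reflTransGen {n : ℕ} {s t : A} (h : OptStep r n s t) :
    ReflTransGen (AnyStep r) s t := by
  rcases h with rfl | h
  · exact .refl
  · exact .single ⟨n, h⟩

/-- A conversion with labels less than `k` before a step with label at least `k` can be replaced
by a rewrite sequence, up to a conversion with smaller labels than that of the step. -/
def RewritesBefore (r : ℕ → A → A → Prop) (k : ℕ) : Prop :=
  ∀ n, k ≤ n → ∀ s s' u, ConvBelow r k s s' → r n s' u →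
    ∃ v, ReflTransGen (AnyStep r) s v ∧ ConvBelow r n v u

/-- The conversion between consecutive label-`j` steps is carried along below the sequence, and each
step is simulated from above it by `hZ`. -/
theorem RewritesBefore.reflTransGen {j : ℕ} (hZ : RewritesBefore r j) {s v : A}
    (h : ReflTransGen (OptStepModulo r j) s v) :
    ∃ v', ReflTransGen (AnyStep r) s v' ∧ ConvBelow r j v' v := by
  induction h with
  | refl => exact ⟨s, .refl, .refl _ _⟩
  | @tail b c _ hbc ih =>
    obtain ⟨v', hv, hvb⟩ := ih
    obtain ⟨b', c', hb, hbc, hc⟩ := hbc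
    rcases hbc with rfl | hbc
    · exact ⟨v', hv, (hvb.trans hb).trans hc⟩
    · obtain ⟨v'', h₁, h₂⟩ := hZ j le_rfl _ _ _ (hvb.trans hb) hbc
      exact ⟨v'', hv.trans h₁, h₂.trans hc⟩

/-- One side of the valley for the conversion is made genuine, while the step is pushed down the
other side. A surviving residue is then preceded only by a conversion below `j`, so `hZ` applies
once more. -/
theorem RewritesBefore.succ {j : ℕ} (hX : PeaksModuloDecreasing r j) (hZ : RewritesBefore r j) :
    RewritesBefore r (j + 1) := by
  intro n hn s s' u hss hsu
  have hn : j < n := hn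
  obtain ⟨v, hsv, hsv'⟩ := hX.join hss
  obtain ⟨v', hv, hvv⟩ := hZ.reflTransGen hsv
  rcases hX.push hn hsu hsv' with hu | ⟨u₁, s₁, hu, hs, hv'⟩
  · exact ⟨v', hv, (hvv.mono hn.le).trans hu.symm⟩
  · obtain ⟨v'', h₁, h₂⟩ := hZ n hn.le _ _ _ (hvv.trans hv'.symm) hs
    exact ⟨v'', hv.trans h₁, h₂.trans hu.symm⟩

theorem rewritesBefore
    (hr : ∀ m n s t u, r m s t → r n s u → DecreasingJoin r m n t u) (k : ℕ) :
    RewritesBefore r k := by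
  induction k with
  | zero =>
    intro n _ s s' u hss hsu
    obtain rfl := hss.eq_of_zero
    exact ⟨u, .single ⟨n, hsu⟩, .refl _ _⟩
  | succ j ih => exact ih.succ (peaksModuloDecreasing hr j)

/-- Making both sides of the valley modulo smaller labels genuine leaves a gap at the bottom with
labels below `j`, which the induction hypothesis closes. -/
theorem ConvBelow.join (hr : ∀ m n s t u, r m s t → r n s u → DecreasingJoin r m n t u) {k : ℕ}
    {s t : A} (h : ConvBelow r k s t) : Join (ReflTransGen (AnyStep r)) s t := by
  induction k generalizing s t with
  | zero => obtain rfl := h.eq_of_zero; exact ⟨s, .refl, .refl⟩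
  | succ j ih =>
    obtain ⟨v, hs, ht⟩ := (peaksModuloDecreasing hr j).join h
    obtain ⟨s', hs, hs'⟩ := (rewritesBefore hr j).reflTransGen hs
    obtain ⟨t', ht, ht'⟩ := (rewritesBefore hr j).reflTransGen ht
    obtain ⟨w, h₁, h₂⟩ := ih (hs'.trans ht'.symm)
    exact ⟨w, hs.trans h₁, ht.trans h₂⟩

theorem exists_convBelow {s t : A} (h : ReflTransGen (AnyStep r) s t) :
    ∃ k, ConvBelow r k s t := by
  induction h with
  | refl => exact ⟨0, .refl _ _⟩
  | tail _ h ih =>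
    obtain ⟨k, hk⟩ := ih
    obtain ⟨n, hn⟩ := h
    exact ⟨max k (n + 1), (hk.mono (le_max_left _ _)).trans
      (.of_step (lt_of_lt_of_le n.lt_succ_self (le_max_right _ _)) hn)⟩

/-- If all local peaks are decreasing, in the sense that they can be closed by conversions, then
the union of the step relations is confluent. -/
theorem confluent_of_decreasingJoin
    (hr : ∀ m n s t u, r m s t → r n s u → DecreasingJoin r m n t u) {s t u : A}
    (hst : ReflTransGen (AnyStep r) s t) (hsu : ReflTransGen (AnyStep r) s u) :
    Join (ReflTransGen (AnyStep r)) t u := by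
  obtain ⟨k, hk⟩ := exists_convBelow hst
  obtain ⟨l, hl⟩ := exists_convBelow hsu
  exact ((hk.symm.mono (le_max_left k l)).trans (hl.mono (le_max_right k l))).join hr

end Abstract

/-! ### Positions and contexts -/

theorem exists_context {s w : L.Term V} {p : List ℕ} (h : subtermAt s p = some w) :
    ∃ C : Context L V, C.holePos = p ∧ C.fill w = s := by
  induction p generalizing s with
  | nil => exact ⟨.hole, rfl, by simpa [subtermAt, Context.fill] using h.symm⟩
  | cons j q ih =>
    cases s with
    | var x => simp [subtermAt] at h
    | @func n f ts =>
      by_cases hj : j < n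
      · simp only [subtermAt, hj, dite_true] at h
        obtain ⟨C, hC, hw⟩ := ih h
        exact ⟨.node f ⟨j, hj⟩ ts C, by simp [Context.holePos, hC], by simp [Context.fill, hw]⟩
      · simp [subtermAt, hj] at h

theorem subtermAt_holePos (C : Context L V) (t : L.Term V) :
    subtermAt (C.fill t) C.holePos = some t := by
  simpa [subtermAt] using subtermAt_fill C t []

theorem replaceAt_holePos (C : Context L V) (t r : L.Term V) :
    replaceAt (C.fill t) C.holePos r = C.fill r := by
  simpa [replaceAt] using replaceAt_fill C t r []

theorem subtermAt_append {s w : L.Term V} {p : List ℕ} (h : subtermAt s p = some w)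
    (q : List ℕ) : subtermAt s (p ++ q) = subtermAt w q := by
  obtain ⟨C, rfl, rfl⟩ := exists_context h
  exact subtermAt_fill C w q

theorem subtermAt_replaceAt_parallel {s : L.Term V} {p q : List ℕ} (h : ParallelPos p q)
    (r : L.Term V) : subtermAt (replaceAt s p r) q = subtermAt s q := by
  induction p generalizing s q with
  | nil => exact absurd List.nil_prefix h.1
  | cons j p ih =>
    cases q with
    | nil => exact absurd List.nil_prefix h.2
    | cons k q =>
      cases s with
      | var x => rfl
      | @func n f ts =>
        by_cases hj : j < n
        · by_cases hk : k < n
          · simp only [replaceAt, subtermAt, hj, hk, dite_true]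
            by_cases hjk : k = j
            · subst hjk
              have : ParallelPos p q := by simpa [ParallelPos, List.cons_prefix_cons] using h
              simp [ih this]
            · rw [Function.update_of_ne (by simpa using hjk)]
          · simp [replaceAt, subtermAt, hj, hk]
        · simp [replaceAt, hj]

theorem replaceAt_comm {s : L.Term V} {p q : List ℕ} (h : ParallelPos p q) (r r' : L.Term V) :
    replaceAt (replaceAt s p r) q r' = replaceAt (replaceAt s q r') p r := by
  induction p generalizing s q with
  | nil => exact absurd List.nil_prefix h.1
  | cons j p ih =>
    cases q with
    | nil => exact absurd List.nil_prefix h.2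
    | cons k q =>
      cases s with
      | var x => rfl
      | @func n f ts =>
        by_cases hj : j < n
        · by_cases hk : k < n
          · simp only [replaceAt, hj, hk, dite_true]
            by_cases hjk : k = j
            · subst hjk
              have : ParallelPos p q := by simpa [ParallelPos, List.cons_prefix_cons] using h
              simp [ih this]
            · rw [Function.update_of_ne (by simpa using hjk),
                Function.update_of_ne (by simpa using Ne.symm hjk), Function.update_comm]
              simpa using Ne.symm hjk
          · simp [replaceAt, hj, hk]
        · by_cases hk : k < n <;> simp [replaceAt, hj, hk]

/-! ### Substitutions and occurrences of variables -/

theorem subst_var (t : L.Term V) : t.subst Term.var = t := by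
  induction t with
  | var x => rfl
  | func f ts ih => simp only [Term.subst]; congr 1; funext j; exact ih j

theorem occ_arg_le {n : ℕ} (f : L.Functions n) (ts : Fin n → L.Term V) (j : Fin n) (x : V) :
    occ x (ts j) ≤ occ x (Term.func f ts) :=
  Finset.single_le_sum (f := fun j => occ x (ts j)) (fun _ _ => Nat.zero_le _) (Finset.mem_univ j)

theorem subst_congr {t : L.Term V} {σ τ : V → L.Term V} (h : ∀ x, 0 < occ x t → σ x = τ x) :
    t.subst σ = t.subst τ := by
  induction t with
  | var x => exact h x (by simp [occ])
  | func f ts ih =>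
    simp only [Term.subst]
    congr 1
    funext j
    exact ih j fun x hx => h x (hx.trans_le (occ_arg_le f ts j x))

/-- In a linear term, a variable occurs in at most one argument. -/
theorem occ_arg_unique {n : ℕ} {f : L.Functions n} {ts : Fin n → L.Term V} {x : V}
    (h : occ x (Term.func f ts) ≤ 1) {j k : Fin n} (hj : 0 < occ x (ts j))
    (hk : 0 < occ x (ts k)) : j = k := by
  by_contra hne
  have h₁ : ∑ i ∈ {j, k}, occ x (ts i) ≤ occ x (Term.func f ts) :=
    Finset.sum_le_sum_of_subset (Finset.subset_univ _)
  rw [Finset.sum_pair hne] at h₁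
  omega

theorem LinearTerm.arg {n : ℕ} {f : L.Functions n} {ts : Fin n → L.Term V}
    (h : LinearTerm (Term.func f ts)) (j : Fin n) : LinearTerm (ts j) :=
  fun x => (occ_arg_le f ts j x).trans (h x)

theorem occ_le_of_subtermAt {s t : L.Term V} {p : List ℕ} (h : subtermAt s p = some t) (x : V) :
    occ x t ≤ occ x s := by
  induction p generalizing s with
  | nil => simp only [subtermAt, Option.some.injEq] at h; rw [h]
  | cons j q ih =>
    cases s with
    | var y => simp [subtermAt] at h
    | @func n f ts =>
      by_cases hj : j < n
      · simp only [subtermAt, hj, dite_true] at h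
        exact (ih h).trans (occ_arg_le f ts ⟨j, hj⟩ x)
      · simp [subtermAt, hj] at h

theorem exists_subtermAt_var {x : V} {t : L.Term V} (h : 0 < occ x t) :
    ∃ p, subtermAt t p = some (.var x) := by
  induction t with
  | var y =>
    obtain rfl : y = x := by
      by_contra hne
      simp [occ, hne] at h
    exact ⟨[], rfl⟩
  | func f ts ih =>
    simp only [occ] at h
    obtain ⟨j, _, hj⟩ := Finset.exists_ne_zero_of_sum_ne_zero h.ne'
    obtain ⟨p, hp⟩ := ih j (Nat.pos_of_ne_zero hj)
    exact ⟨j :: p, by simpa [subtermAt] using hp⟩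

/-- Replacement below the only occurrence of a variable is a change of the substitution. -/
theorem subst_update_replaceAt [DecidableEq V] {t : L.Term V} {x : V} {p : List ℕ}
    (ht : occ x t ≤ 1) (hp : subtermAt t p = some (.var x)) (σ : V → L.Term V) (q : List ℕ)
    (r : L.Term V) :
    replaceAt (t.subst σ) (p ++ q) r =
      t.subst (Function.update σ x (replaceAt (σ x) q r)) := by
  induction p generalizing t with
  | nil =>
    simp only [subtermAt, Option.some.injEq] at hp
    subst hp
    simp [Term.subst]
  | cons j p ih =>
    cases t with
    | var y => simp [subtermAt] at hp
    | @func n f ts =>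
      by_cases hj : j < n
      · simp only [subtermAt, hj, dite_true] at hp
        simp only [Term.subst, List.cons_append, replaceAt, hj, dite_true]
        rw [ih ((occ_arg_le f ts ⟨j, hj⟩ x).trans ht) hp]
        congr 1
        funext k
        by_cases hk : k = ⟨j, hj⟩
        · subst hk; simp
        · rw [Function.update_of_ne hk]
          -- The only occurrence of `x` is in argument `j`, so the update does not affect the other
          -- arguments.
          refine subst_congr fun y hy => ?_
          rw [Function.update_of_ne]
          rintro rfl
          refine hk (occ_arg_unique ht hy (lt_of_lt_of_le ?_ (occ_le_of_subtermAt hp y)))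
          simp [occ]
      · simp [subtermAt, hj] at hp

/-- A position of an instance that is not a function symbol position of the term is below a
variable. -/
theorem exists_var_of_not_isFunPos {t w : L.Term V} {σ : V → L.Term V} {p : List ℕ}
    (hp : ¬ IsFunPos t p) (h : subtermAt (t.subst σ) p = some w) :
    ∃ x p₁ p₂, p = p₁ ++ p₂ ∧ subtermAt t p₁ = some (.var x) ∧
      subtermAt (σ x) p₂ = some w := by
  induction p generalizing t with
  | nil =>
    cases t with
    | var x => exact ⟨x, [], [], rfl, rfl, h⟩
    | func f ts => exact absurd ⟨_, rfl, fun x => by simp⟩ hp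
  | cons j q ih =>
    cases t with
    | var x => exact ⟨x, [], j :: q, rfl, rfl, h⟩
    | @func n f ts =>
      by_cases hj : j < n
      · simp only [Term.subst, subtermAt, hj, dite_true] at h
        have hq : ¬ IsFunPos (ts ⟨j, hj⟩) q := by
          simpa [IsFunPos, subtermAt, hj] using hp
        obtain ⟨x, p₁, p₂, rfl, h₁, h₂⟩ := ih hq h
        exact ⟨x, j :: p₁, p₂, rfl, by simpa [subtermAt, hj] using h₁, h₂⟩
      · simp [Term.subst, subtermAt, hj] at h

/-! ### Compatibility of the rule labeling -/

theorem ruleLabeling_isLabeling {R : TRS L V} (i : R → ℕ) :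
    IsLabeling (ruleLabeling i) (· > ·) (· ≥ ·) :=
  ⟨fun _ _ _ _ h => h, fun _ _ _ _ h => h, fun _ => rfl⟩

/-- A local peak that is closed by at most one step on each side, with the same rules. -/
theorem extLocDecreasing_of_opt {R : TRS L V} (i : R → ℕ) (a b : Step R) {v : L.Term V}
    (hb : ∃ c, IsOptForward a.target c v ∧ ∀ d ∈ c, d.step.rule = b.rule)
    (ha : ∃ c, IsOptBackward v c b.target ∧ ∀ d ∈ c, d.step.rule = a.rule) :
    ExtLocDecreasing (ruleLabeling i) (· > ·) (· ≥ ·) a b := by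
  obtain ⟨c, hc, hcb⟩ := hb
  obtain ⟨c', hc', hca⟩ := ha
  refine ⟨a.target, v, v, b.target, [], c, [], c', [], rfl, hc, rfl, hc', rfl,
    ?_, ?_, ?_, ?_, ?_⟩
  · rintro _ ⟨d, hd, rfl⟩; simp at hd
  · rintro _ ⟨d, hd, rfl⟩; exact ⟨_, rfl, by simp [ruleLabeling, hcb d hd, Step.fwd]⟩
  · rintro _ ⟨d, hd, rfl⟩; simp at hd
  · rintro _ ⟨d, hd, rfl⟩; exact ⟨_, rfl, by simp [ruleLabeling, hca d hd, Step.bwd]⟩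
  · rintro _ ⟨d, hd, rfl⟩; simp at hd

theorem Step.isOptForward {R : TRS L V} (a : Step R) : IsOptForward a.source [a.fwd] a.target :=
  ⟨⟨rfl, rfl⟩, by simp, by simp [Step.fwd]⟩

theorem Step.isOptBackward {R : TRS L V} (a : Step R) :
    IsOptBackward a.target [a.bwd] a.source :=
  ⟨⟨rfl, rfl⟩, by simp, by simp [Step.bwd]⟩

theorem extLocDecreasing_of_parallel {R : TRS L V} (i : R → ℕ) {a b : Step R}
    (h : IsParallelPeak a b) : ExtLocDecreasing (ruleLabeling i) (· > ·) (· ≥ ·) a b := by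
  obtain ⟨hs, hp⟩ := h
  have hs : a.source = b.source := hs
  let b' : Step R := ⟨a.target, _, b.pos, b.rule, b.subst, by
    rw [a.target_eq, subtermAt_replaceAt_parallel hp, hs, b.source_at], rfl⟩
  let a' : Step R := ⟨b.target, _, a.pos, a.rule, a.subst, by
    rw [b.target_eq, subtermAt_replaceAt_parallel hp.symm, ← hs, a.source_at], rfl⟩
  have hv : a'.target = b'.target := by
    rw [a'.target_eq, b'.target_eq]
    change replaceAt b.target _ _ = replaceAt a.target _ _
    rw [a.target_eq, b.target_eq, hs]
    exact replaceAt_comm hp.symm _ _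
  exact extLocDecreasing_of_opt i a b (v := b'.target)
    ⟨_, b'.isOptForward, by simp [Step.fwd, b']⟩
    ⟨_, hv ▸ a'.isOptBackward, by simp [Step.bwd, a']⟩

/-- The inner step acts inside the value of a variable `x` that occurs once in the left-hand side,
so it amounts to updating the substitution at `x`. The outer rule still applies, with the updated
substitution `τ`. -/
theorem extLocDecreasing_of_variable {R : TRS L V} (hR : LinearTRS R) (i : R → ℕ) {a b : Step R}
    (h : IsVariablePeak a b) : ExtLocDecreasing (ruleLabeling i) (· > ·) (· ≥ ·) a b := by
  classical
  obtain ⟨hs, q, hq, hfun⟩ := h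
  have hs : a.source = b.source := hs
  have ha := a.source_at
  rw [hs, hq, subtermAt_append b.source_at] at ha
  obtain ⟨x, p₁, p₂, rfl, hp₁, hp₂⟩ := exists_var_of_not_isFunPos hfun ha
  obtain ⟨hl, hr⟩ := hR _ b.rule.2
  obtain ⟨C, hC, hCs⟩ := exists_context b.source_at
  set w := a.rule.1.rhs.subst a.subst
  set τ := Function.update b.subst x (replaceAt (b.subst x) p₂ w) with hτ
  have hat : a.target = C.fill (b.rule.1.lhs.subst τ) := by
    rw [a.target_eq, hs, hq, ← hCs, ← hC, replaceAt_fill,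
      subst_update_replaceAt (hl x) hp₁]
  have hbt : b.target = C.fill (b.rule.1.rhs.subst b.subst) := by
    rw [b.target_eq, ← hCs, ← hC, replaceAt_holePos]
  let b' : Step R := ⟨a.target, C.fill (b.rule.1.rhs.subst τ), C.holePos, b.rule, τ, by
    rw [hat, subtermAt_holePos], by rw [hat, replaceAt_holePos]⟩
  refine extLocDecreasing_of_opt i a b (v := b'.target)
    ⟨_, b'.isOptForward, by simp [Step.fwd, b']⟩ ?_
  -- If `x` occurs on the right, it does so once, and one inner step turns the old substitution into
  -- `τ`; otherwise the inner redex is erased and no step is needed.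
  by_cases hx : 0 < occ x b.rule.1.rhs
  · obtain ⟨p₃, hp₃⟩ := exists_subtermAt_var hx
    have hrep := subst_update_replaceAt (hr x) hp₃ b.subst p₂ w
    let a' : Step R := ⟨b.target, b'.target, C.holePos ++ (p₃ ++ p₂), a.rule, a.subst, by
      rw [hbt, subtermAt_fill, subtermAt_append (subtermAt_subst _ hp₃)]; exact hp₂, by
      rw [hbt, replaceAt_fill, hrep]⟩
    exact ⟨_, a'.isOptBackward, by simp [Step.bwd, a']⟩
  · refine ⟨[], ⟨?_, by simp, by simp⟩, by simp⟩
    change C.fill (b.rule.1.rhs.subst τ) = b.target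
    rw [hbt]
    congr 1
    refine subst_congr fun y hy => ?_
    rw [hτ, Function.update_of_ne]
    rintro rfl
    exact hx hy

theorem ruleLabeling_compatible {R : TRS L V} (hR : LinearTRS R) (i : R → ℕ) :
    Compatible (ruleLabeling i) (· > ·) (· ≥ ·) :=
  ⟨ruleLabeling_isLabeling i, fun _ _ => extLocDecreasing_of_parallel i,
    fun _ _ => extLocDecreasing_of_variable hR i⟩

/-! ### Unification of linear terms without common variables -/

/-- Unifiable linear terms without common variables have an idempotent most general unifier. -/
theorem exists_mgu_of_linear {s t : L.Term V} (hs : LinearTerm s) (ht : LinearTerm t)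
    (hd : ∀ x, 0 < occ x s → ¬ 0 < occ x t) {τ : V → L.Term V} (h : s.subst τ = t.subst τ) :
    ∃ μ : V → L.Term V, s.subst μ = t.subst μ ∧
      ∀ θ : V → L.Term V, s.subst θ = t.subst θ → ∀ x, θ x = (μ x).subst θ := by
  classical
  -- A variable is bound to the other term; disjointness of variables plays the role of the occurs
  -- check.
  have bind : ∀ (y : V) (t : L.Term V), ¬ 0 < occ y t → ∃ μ : V → L.Term V,
      (Term.var y).subst μ = t.subst μ ∧
        ∀ θ : V → L.Term V, (Term.var y).subst θ = t.subst θ → ∀ x, θ x = (μ x).subst θ := by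
    intro y t hy
    refine ⟨Function.update .var y t, ?_, fun θ hθ x => ?_⟩
    · have h₁ : t.subst (Function.update .var y t) = t.subst Term.var :=
        subst_congr fun x hx => Function.update_of_ne (by rintro rfl; exact hy hx) _ _
      simp [Term.subst, h₁, subst_var]
    · by_cases hx : x = y
      · subst hx; simpa [Term.subst] using hθ
      · simp [Function.update_of_ne hx, Term.subst]
  induction s generalizing t with
  | var y => exact bind y t (hd y (by simp [occ]))
  | @func n f ss ih =>
    cases t with
    | var y =>
      obtain ⟨μ, h₁, h₂⟩ := bind y (.func f ss) fun hy => hd y hy (by simp [occ])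
      exact ⟨μ, h₁.symm, fun θ hθ => h₂ θ hθ.symm⟩
    | @func m g ts =>
      simp only [Term.subst, Term.func.injEq] at h
      obtain ⟨rfl, hfg, hargs⟩ := h
      obtain rfl := eq_of_heq hfg
      have hargs := congrFun (eq_of_heq hargs)
      have hdj : ∀ j k x, 0 < occ x (ss j) → ¬ 0 < occ x (ts k) := fun j k x hx hx' =>
        hd x (hx.trans_le (occ_arg_le f ss j x)) (hx'.trans_le (occ_arg_le f ts k x))
      choose μ hμ hmgu using fun j => ih j (hs.arg j) (ht.arg j) (hdj j j) (hargs j)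
      -- By linearity and disjointness a variable belongs to only one pair of arguments, so the
      -- unifiers of the pairs can be glued. Generality survives the gluing because every unifier
      -- `θ` factors through each `μ j` by `θ` itself.
      let ν : V → L.Term V := fun x =>
        if hx : ∃ j, 0 < occ x (ss j) ∨ 0 < occ x (ts j) then μ hx.choose x else .var x
      have hν : ∀ j x, 0 < occ x (ss j) ∨ 0 < occ x (ts j) → ν x = μ j x := by
        intro j x hx
        have hex : ∃ j, 0 < occ x (ss j) ∨ 0 < occ x (ts j) := ⟨j, hx⟩
        have hj : hex.choose = j := by
          rcases hex.choose_spec with h₁ | h₁ <;> rcases hx with h₂ | h₂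
          · exact occ_arg_unique (hs x) h₁ h₂
          · exact absurd h₂ (hdj _ _ x h₁)
          · exact absurd h₁ (hdj _ _ x h₂)
          · exact occ_arg_unique (ht x) h₁ h₂
        simp only [ν, dif_pos hex, hj]
      refine ⟨ν, ?_, fun θ hθ x => ?_⟩
      · simp only [Term.subst]
        congr 1
        funext j
        rw [subst_congr fun x hx => hν j x (Or.inl hx), hμ j]
        exact (subst_congr fun x hx => hν j x (Or.inr hx)).symm
      · by_cases hx : ∃ j, 0 < occ x (ss j) ∨ 0 < occ x (ts j)
        · obtain ⟨j, hj⟩ := hx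
          rw [hν j x hj]
          simp only [Term.subst, Term.func.injEq, heq_eq_eq, true_and] at hθ
          exact hmgu j θ (congrFun hθ j) x
        · simp only [ν, dif_neg hx, Term.subst]

/-! ### Variants -/

theorem occ_relabel (e : Equiv.Perm V) (x : V) (t : L.Term V) :
    occ x (t.relabel e) = occ (e.symm x) t := by
  induction t with
  | var y =>
    have h : e y = x ↔ y = e.symm x := (Equiv.eq_symm_apply e).symm
    classical exact if_congr h rfl rfl
  | func f ts ih => simp only [Term.relabel, occ, ih]

theorem subtermAt_relabel (g : V → V) {s t : L.Term V} {p : List ℕ}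
    (h : subtermAt s p = some t) : subtermAt (s.relabel g) p = some (t.relabel g) := by
  -- A renaming is a substitution by variables.
  rw [← subst_var (s.relabel g), ← subst_var (t.relabel g), relabel_subst, relabel_subst]
  exact subtermAt_subst _ h

theorem LinearTerm.relabel {t : L.Term V} (h : LinearTerm t) (e : Equiv.Perm V) :
    LinearTerm (t.relabel e) := fun x => by rw [occ_relabel]; exact h _

theorem LinearTerm.subtermAt {s t : L.Term V} (hs : LinearTerm s) {p : List ℕ}
    (h : subtermAt s p = some t) : LinearTerm t :=
  fun x => (occ_le_of_subtermAt h x).trans (hs x)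

theorem finite_occ (t : L.Term V) : {x | 0 < occ x t}.Finite := by
  induction t with
  | var y =>
    refine (Set.finite_singleton y).subset fun x hx => ?_
    by_contra hne
    have hne : ¬ y = x := fun h => hne h.symm
    simp [occ, hne] at hx
  | func f ts ih =>
    refine (Set.finite_iUnion ih).subset fun x hx => ?_
    simp only [occ, Set.mem_ofPred_eq] at hx
    obtain ⟨j, _, hj⟩ := Finset.exists_ne_zero_of_sum_ne_zero hx.ne'
    exact Set.mem_iUnion.mpr ⟨j, Nat.pos_of_ne_zero hj⟩

theorem Rule.finite_vars (ρ : Rule L V) : ρ.vars.Finite :=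
  (finite_occ ρ.lhs).union (finite_occ ρ.rhs)

theorem Rule.mem_vars_rename {e : Equiv.Perm V} {ρ : Rule L V} {x : V} :
    x ∈ (ρ.rename e).vars ↔ e.symm x ∈ ρ.vars := by
  simp only [Rule.vars, Rule.rename, Set.mem_ofPred_eq, occ_relabel]

/-- A finite set can be moved away from another one by a permutation of an infinite type. -/
theorem exists_perm_avoiding {α : Type*} [Infinite α] {A B : Set α} (hA : A.Finite)
    (hB : B.Finite) : ∃ e : Equiv.Perm α, ∀ x ∈ A, e x ∉ B := by
  classical
  induction A, hA using Set.Finite.induction_on with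
  | empty => exact ⟨1, by simp⟩
  | @insert a A ha hA ih =>
    obtain ⟨e, he⟩ := ih
    obtain ⟨c, hc⟩ := (hB.union (hA.image e)).exists_notMem
    simp only [Set.mem_union, not_or] at hc
    -- The point `c` lies outside `B` and outside the image of `A`, so the swap moves `a` to `c`
    -- without disturbing the images of the other points.
    refine ⟨e.trans (Equiv.swap (e a) c), fun x hx => ?_⟩
    rcases hx with rfl | hx
    · simpa using hc.1
    · have h₁ : e x ≠ e a := fun h => ha (e.injective h ▸ hx)
      have h₂ : e x ≠ c := fun h => hc.2 ⟨x, hx, h⟩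
      rw [Equiv.trans_apply, Equiv.swap_apply_of_ne_of_ne h₁ h₂]
      exact he x hx

/-! ### Critical peaks -/

/-- Every overlap of two steps is an instance of a critical peak. -/
theorem exists_criticalOverlap [Infinite V] {R : TRS L V} (hR : LinearTRS R) {a b : Step R}
    (hs : a.source = b.source) {q : List ℕ} (hq : a.pos = b.pos ++ q)
    (hfun : IsFunPos b.rule.1.lhs q) :
    ∃ (o : CriticalOverlap R) (C : Context L V) (δ : V → L.Term V),
      o.rule₁ = a.rule ∧ o.rule₂ = b.rule ∧ C.fill (o.inner.target.subst δ) = a.target ∧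
        C.fill (o.outer.target.subst δ) = b.target := by
  classical
  have ha := a.source_at
  rw [hs, hq, subtermAt_append b.source_at] at ha
  obtain ⟨C, hC, hCs⟩ := exists_context b.source_at
  obtain ⟨e, he⟩ := exists_perm_avoiding a.rule.1.finite_vars b.rule.1.finite_vars
  set ρ₁ := a.rule.1.rename e with hρ₁
  set ρ₂ := b.rule.1.rename (1 : Equiv.Perm V) with hρ₂
  have hmem₁ : ∀ {x}, x ∈ ρ₁.vars ↔ e.symm x ∈ a.rule.1.vars := Rule.mem_vars_rename
  have hmem₂ : ∀ {x}, x ∈ ρ₂.vars ↔ x ∈ b.rule.1.vars := Rule.mem_vars_rename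
  have apart : Disjoint ρ₁.vars ρ₂.vars := by
    rw [Set.disjoint_left]
    intro x hx hx'
    have := he _ (hmem₁.mp hx)
    rw [Equiv.apply_symm_apply] at this
    exact this (hmem₂.mp hx')
  -- Once the rules share no variables, the substitutions of both steps merge into one. Variables
  -- occurring only in a right-hand side count as rule variables, so `τ` also agrees with the steps
  -- there.
  let τ : V → L.Term V := fun x =>
    if x ∈ ρ₁.vars then a.subst (e.symm x) else b.subst x
  have hτ₁ : ∀ x ∈ a.rule.1.vars, τ (e x) = a.subst x := by
    intro x hx
    have : e x ∈ ρ₁.vars := hmem₁.mpr (by simpa using hx)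
    simp [τ, this]
  have hτ₂ : ∀ x ∈ b.rule.1.vars, τ x = b.subst x := by
    intro x hx
    have : x ∉ ρ₁.vars := fun h => Set.disjoint_left.mp apart h (hmem₂.mpr hx)
    simp [τ, this]
  have hl₁ : ρ₁.lhs.subst τ = a.rule.1.lhs.subst a.subst :=
    (relabel_subst _ _ _).trans (subst_congr fun x hx => hτ₁ x (Or.inl hx))
  have hr₁ : ρ₁.rhs.subst τ = a.rule.1.rhs.subst a.subst :=
    (relabel_subst _ _ _).trans (subst_congr fun x hx => hτ₁ x (Or.inr hx))
  have hl₂ : ρ₂.lhs.subst τ = b.rule.1.lhs.subst b.subst :=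
    (relabel_subst _ _ _).trans (subst_congr fun x hx => hτ₂ x (Or.inl hx))
  have hr₂ : ρ₂.rhs.subst τ = b.rule.1.rhs.subst b.subst :=
    (relabel_subst _ _ _).trans (subst_congr fun x hx => hτ₂ x (Or.inr hx))
  obtain ⟨s, hsub, hsv⟩ := hfun
  have hsub' : subtermAt ρ₂.lhs q = some (s.relabel (1 : Equiv.Perm V)) :=
    subtermAt_relabel _ hsub
  have hfun' : IsFunPos ρ₂.lhs q := by
    refine ⟨_, hsub', fun x => ?_⟩
    cases s with
    | var y => exact absurd rfl (hsv y)
    | func f ts => simp [Term.relabel]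
  have hunif : ρ₁.lhs.subst τ = (s.relabel (1 : Equiv.Perm V)).subst τ := by
    have := subtermAt_subst τ hsub'
    rw [hl₂, ha, Option.some.injEq] at this
    rw [hl₁, this]
  obtain ⟨μ, hμ, hmgu⟩ := exists_mgu_of_linear ((hR _ a.rule.2).1.relabel e)
    (((hR _ b.rule.2).1.relabel 1).subtermAt hsub')
    (fun x hx hx' => Set.disjoint_left.mp apart (Or.inl hx : x ∈ ρ₁.vars)
      (Or.inl (hx'.trans_le (occ_le_of_subtermAt hsub' x)))) hunif
  let o : CriticalOverlap R := ⟨a.rule, b.rule, e, 1, apart, q, hfun', μ, fun s' hs' => by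
    rw [hsub', Option.some.injEq] at hs'
    subst hs'
    exact ⟨hμ, fun θ hθ => ⟨θ, hmgu θ hθ⟩⟩⟩
  -- The unifier factors through `μ` by itself, so `τ` serves as the instantiating substitution of
  -- the critical peak.
  have hτ : (fun x => (μ x).subst τ) = τ := funext fun x => (hmgu τ hunif x).symm
  refine ⟨o, C, τ, rfl, rfl, ?_, ?_⟩
  · have h₁ : o.inner.target.subst τ =
        replaceAt ((ρ₂.lhs.subst μ).subst τ) q ((ρ₁.rhs.subst μ).subst τ) :=
      replaceAt_subst τ o.inner.source_at _
    rw [h₁, subst_subst, subst_subst, hτ, hl₂, hr₁, a.target_eq, hs, hq, ← hCs, ← hC,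
      replaceAt_fill]
  · have h₁ : o.outer.target.subst τ = (ρ₂.rhs.subst μ).subst τ := rfl
    rw [h₁, subst_subst, hτ, hr₂, b.target_eq, ← hCs, ← hC, replaceAt_holePos]

/-! ### Confluence -/

/-- The rewrite steps with a given label. -/
def LabeledStep {R : TRS L V} (i : R → ℕ) (n : ℕ) (s t : L.Term V) : Prop :=
  ∃ a : Step R, a.source = s ∧ a.target = t ∧ i a.rule = n

/-- The map `φ` will be the identity or `t ↦ C[tδ]`; the latter carries the diagram of a critical
peak over to its instances. -/
theorem IsConversion.convBelow {R : TRS L V} {i : R → ℕ} {φ : L.Term V → L.Term V}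
    (hφ : ∀ a : Step R, LabeledStep i (i a.rule) (φ a.source) (φ a.target)) {k : ℕ}
    {c : List (DirStep R)} {s t : L.Term V} (h : IsConversion s c t)
    (hc : ∀ d ∈ c, i d.step.rule < k) : ConvBelow (LabeledStep i) k (φ s) (φ t) := by
  induction c generalizing s with
  | nil => obtain rfl : s = t := h; exact .refl _ _
  | cons d c ih =>
    obtain ⟨rfl, h⟩ := h
    refine Relation.ReflTransGen.head ⟨_, hc d (by simp), ?_⟩
      (ih h fun d' hd' => hc d' (by simp [hd']))
    obtain ⟨a, b⟩ := d
    cases b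
    · exact Or.inr (hφ a)
    · exact Or.inl (hφ a)

/-- An optional step with a label at most `n` has label `n`, or is a conversion with smaller
labels. -/
theorem OptStep.of_list {R : TRS L V} {i : R → ℕ} {φ : L.Term V → L.Term V}
    (hφ : ∀ a : Step R, LabeledStep i (i a.rule) (φ a.source) (φ a.target)) {n : ℕ}
    {c : List (DirStep R)} {s t : L.Term V} (h : IsOptForward s c t ∨ IsOptBackward t c s)
    (hc : ∀ d ∈ c, i d.step.rule ≤ n) :
    ∃ v, OptStep (LabeledStep i) n (φ s) v ∧ ConvBelow (LabeledStep i) n v (φ t) := by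
  have step : ∀ a : Step R, i a.rule ≤ n → ∃ v, OptStep (LabeledStep i) n (φ a.source) v ∧
      ConvBelow (LabeledStep i) n v (φ a.target) := by
    intro a ha
    rcases ha.lt_or_eq with ha | ha
    · exact ⟨_, Or.inl rfl, .of_step ha (hφ a)⟩
    · exact ⟨_, Or.inr (ha ▸ hφ a), .refl _ _⟩
  match c, h, hc with
  | [], h, _ =>
    obtain rfl : s = t := h.elim (fun h => h.1) fun h => h.1.symm
    exact ⟨_, Or.inl rfl, .refl _ _⟩
  | [⟨a, true⟩], h, hc =>
    rcases h with ⟨⟨rfl, h'⟩, _⟩ | ⟨_, _, h⟩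
    · obtain rfl : a.target = t := h'
      exact step a (hc ⟨a, true⟩ (by simp))
    · simp at h
  | [⟨a, false⟩], h, hc =>
    rcases h with ⟨_, _, h⟩ | ⟨⟨rfl, h'⟩, _⟩
    · simp at h
    · obtain rfl : a.source = s := h'
      exact step a (hc ⟨a, false⟩ (by simp))
  | _ :: _ :: _, h, _ => rcases h with ⟨_, h, _⟩ | ⟨_, h, _⟩ <;> simp at h

/-- Extended local decreasingness carries over along maps that preserve labeled steps. -/
theorem ExtLocDecreasing.decreasingJoin {R : TRS L V} {i : R → ℕ} {φ : L.Term V → L.Term V}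
    (hφ : ∀ a : Step R, LabeledStep i (i a.rule) (φ a.source) (φ a.target)) {a b : Step R}
    (h : ExtLocDecreasing (ruleLabeling i) (· > ·) (· ≥ ·) a b) :
    DecreasingJoin (LabeledStep i) (i a.rule) (i b.rule) (φ a.target) (φ b.target) := by
  obtain ⟨t', t'', u'', u', c₁, c₂, c₃, c₄, c₅, h₁, h₂, h₃, h₄, h₅, l₁, l₂, l₃, l₄, l₅⟩ := h
  have e₁ := h₁.convBelow hφ (k := i a.rule) fun d hd => by
    obtain ⟨_, rfl, h⟩ := l₁ ⟨d, hd, rfl⟩; exact h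
  have e₃ := h₃.convBelow hφ (k := max (i a.rule) (i b.rule)) fun d hd => by
    obtain ⟨_, rfl | rfl, h⟩ := l₃ ⟨d, hd, rfl⟩
    · exact lt_max_of_lt_left h
    · exact lt_max_of_lt_right h
  have e₅ := h₅.convBelow hφ (k := i b.rule) fun d hd => by
    obtain ⟨_, rfl, h⟩ := l₅ ⟨d, hd, rfl⟩; exact h
  obtain ⟨v, hv, hv'⟩ := OptStep.of_list hφ (n := i b.rule) (Or.inl h₂) fun d hd => by
    obtain ⟨_, rfl, h⟩ := l₂ ⟨d, hd, rfl⟩; exact h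
  obtain ⟨w, hw, hw'⟩ := OptStep.of_list hφ (n := i a.rule) (Or.inr h₄) fun d hd => by
    obtain ⟨_, rfl, h⟩ := l₄ ⟨d, hd, rfl⟩; exact h
  -- Optional steps with a label strictly below the permitted one are absorbed into the middle
  -- conversion.
  exact ⟨φ t', v, w, φ u', e₁, hv, ((hv'.mono (le_max_right _ _)).trans e₃).trans
    (hw'.symm.mono (le_max_left _ _)), hw, e₅⟩

/-- The lower step either overlaps the left-hand side of the upper one or is a variable peak; a
variable left-hand side always gives the latter. Two steps with the same rule at the same position
need no exception: they may differ in variables that occur only on the right, and root self-overlaps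
are among the critical peaks. -/
theorem decreasingJoin_of_prefix [Infinite V] {R : TRS L V} (hR : LinearTRS R) {i : R → ℕ}
    (hcp : CriticalPeaksDecreasing (ruleLabeling i) (· > ·) (· ≥ ·)) {a b : Step R}
    (hs : a.source = b.source) (hpos : b.pos <+: a.pos) :
    DecreasingJoin (LabeledStep i) (i a.rule) (i b.rule) a.target b.target := by
  obtain ⟨q, hq⟩ := hpos
  by_cases hfun : IsFunPos b.rule.1.lhs q
  · obtain ⟨o, C, δ, h₁, h₂, h₃, h₄⟩ := exists_criticalOverlap hR hs hq.symm hfun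
    rw [← h₁, ← h₂, ← h₃, ← h₄]
    exact (hcp o).decreasingJoin (φ := fun t => C.fill (t.subst δ))
      fun a => ⟨a.inst C δ, rfl, rfl, rfl⟩
  · exact (extLocDecreasing_of_variable hR i ⟨hs, q, hq.symm, hfun⟩).decreasingJoin (φ := id)
      fun a => ⟨a, rfl, rfl, rfl⟩

theorem decreasingJoin_of_localPeak [Infinite V] {R : TRS L V} (hR : LinearTRS R) {i : R → ℕ}
    (hcp : CriticalPeaksDecreasing (ruleLabeling i) (· > ·) (· ≥ ·)) {a b : Step R}
    (hs : a.source = b.source) :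
    DecreasingJoin (LabeledStep i) (i a.rule) (i b.rule) a.target b.target := by
  by_cases h₁ : b.pos <+: a.pos
  · exact decreasingJoin_of_prefix hR hcp hs h₁
  by_cases h₂ : a.pos <+: b.pos
  · exact (decreasingJoin_of_prefix hR hcp hs.symm h₂).symm
  · exact (extLocDecreasing_of_parallel i ⟨hs, h₂, h₁⟩).decreasingJoin (φ := id)
      fun a => ⟨a, rfl, rfl, rfl⟩

theorem rewrites_iff_anyStep {R : TRS L V} (i : R → ℕ) {s t : L.Term V} :
    Rewrites R s t ↔ AnyStep (LabeledStep i) s t := by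
  constructor
  · intro h
    induction h with
    | rule ρ h =>
      exact ⟨_, ⟨ρ.lhs, ρ.rhs, [], ⟨ρ, h⟩, .var, by simp [subtermAt, subst_var],
        by simp [replaceAt, subst_var]⟩, rfl, rfl, rfl⟩
    | subst σ _ ih =>
      obtain ⟨n, a, rfl, rfl, rfl⟩ := ih
      exact ⟨_, a.inst .hole σ, rfl, rfl, rfl⟩
    | context C _ ih =>
      obtain ⟨n, a, rfl, rfl, rfl⟩ := ih
      exact ⟨_, a.inst C .var, by simp [Step.inst, subst_var], by simp [Step.inst, subst_var], rfl⟩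
  · rintro ⟨n, a, rfl, rfl, -⟩
    obtain ⟨C, hC, hCs⟩ := exists_context a.source_at
    rw [a.target_eq, ← hCs, ← hC, replaceAt_holePos]
    exact .context C (.subst _ (.rule _ a.rule.2))

theorem confluent_of_criticalPeaksDecreasing [Infinite V] {R : TRS L V} (hR : LinearTRS R)
    {i : R → ℕ} (hcp : CriticalPeaksDecreasing (ruleLabeling i) (· > ·) (· ≥ ·)) :
    Confluent R := by
  have hrel : Rewrites R = AnyStep (LabeledStep i) := by
    funext s t
    exact propext (rewrites_iff_anyStep i)
  intro s t u hst hsu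
  rw [hrel] at hst hsu ⊢
  refine confluent_of_decreasingJoin ?_ hst hsu
  rintro m n s t u ⟨a, rfl, rfl, rfl⟩ ⟨b, hb, rfl, rfl⟩
  exact decreasingJoin_of_localPeak hR hcp hb.symm

end Rewriting

theorem mainTheorem6 {L : FirstOrder.Language} {V : Type*} [Infinite V]
    (R : Rewriting.TRS L V) (i : R → ℕ) :
    Rewriting.IsLabeling (Rewriting.ruleLabeling i) (· > ·) (· ≥ ·) ∧
    (Rewriting.LinearTRS R →
      Rewriting.Compatible (Rewriting.ruleLabeling i) (· > ·) (· ≥ ·)) ∧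
    (Rewriting.LinearTRS R →
      Rewriting.CriticalPeaksDecreasing (Rewriting.ruleLabeling i) (· > ·) (· ≥ ·) →
      Rewriting.Confluent R) :=
  ⟨Rewriting.ruleLabeling_isLabeling i, fun hR => Rewriting.ruleLabeling_compatible hR i,
    fun hR hcp => Rewriting.confluent_of_criticalPeaksDecreasing hR hcp⟩
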